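/- Let $\rho,\sigma$ be density matrices on a finite-dimensional Hilbert space $\mathcal H$ of dimension $d$. Let $\mathcal H_S=\operatorname{supp}\rho+\operatorname{supp}\sigma$ be their joint support, $\mathcal H=\mathcal H_S\oplus\mathcal H_\bot$ the orthogonal decomposition, and $d_\bot=\dim\mathcal H_\bot$. Let $\{|i\rangle\}_{i=1}^n$ be an orthonormal basis of $\mathcal H_S$ with $\rho=\sum_i p_i|i\rangle\langle i|$; so $d=n+d_\bot$. For a Hermitian $K$ on $\mathcal H\otimes\mathcal H$ (first factor $A$, second factor $B$) the optimal transport cost is $$\mathcal K(\rho,\sigma)=\min_{J}\operatorname{Tr}\Big[K\,\tfrac12\big((\rho\otimes 1)J+J(\rho\otimes 1)\big)\Big],$$ the minimum being over all $J$ on $\mathcal H\otimes\mathcal H$ with $J^{T_A}\ge 0$, $\operatorname{Tr}_BJ=1$ and $\operatorname{Tr}_A[(\rho\otimes 1)J]=\sigma$, where $T_A$ is the partial transpose on the first factor. Take the unitarily invariant cost matrix $K=1-\frac1d\mathbb S$, with $\mathbb S$ the swap operator. Then the minimum is attained, all the maxima below exist, the numbers under the square roots are real and nonnegative, and $$\mathcal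 K(\rho,\sigma)=1-\frac1d\max_{\{E_k\}}\Big(\operatorname{Re}\Big[\sum_k\operatorname{Tr}[E_k\rho]\operatorname{Tr}[E_k^*]\Big]+d_\bot\sqrt{\textstyle\sum_k|\operatorname{Tr}(E_k\rho)|^2}\Big)$$ $$=1-\frac1d\max_{\mathcal E}\Big(\operatorname{Re}\Big[\sum_{ij}p_i\langle i|\mathcal E(|i\rangle\langle j|)|j\rangle\Big]+d_\bot\sqrt{\textstyle\sum_{ij}p_ip_j\langle i|\mathcal E(|i\rangle\langle j|)|j\rangle}\Big),$$ where the maximisation is over completely positive trace-preserving maps $\mathcal E(\bullet)=\sum_kE_k\bullet E_k^*$ on $\mathcal B(\mathcal H_S)$ with $\mathcal E(\rho)=\sigma$ (in the first line, over all finite Kraus families of such maps). Equivalently, $$\mathcal K(\rho,\sigma)=1-\frac1d\max_{C_S}\Big(\operatorname{Re}\langle\rho|C_S|\Phi_S\rangle+d_\bot\sqrt{\langle\rho|C_S|\rho\rangle}\Big),$$ where the maximum is over the operators $C_S$ on $\mathcal H_S\otimes\mathcal H_S$ with $C_S\ge 0$, $\operatorname{Tr}_BC_S=1_S$ and $\operatorname{Tr}_A[(\rho^T\otimes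 1)C_S]=\sigma$. Here $|\Phi_S\rangle=\sum_{i=1}^n|ii\rangle$, $|\rho\rangle=\sum_ip_i|ii\rangle$, and the transpose is taken in the basis $\{|i\rangle\}$. -/

import Mathlib

open scoped ComplexOrder Kronecker Matrix

noncomputable section

namespace QTransport

variable {α β ι δ : Type*} [Fintype α] [DecidableEq α] [Fintype β] [DecidableEq β]
  [Fintype ι] [DecidableEq ι] [Fintype δ] [DecidableEq δ]

/-! Operators on the Hilbert space `ℂ^α` are `α × α` matrices, operators on
`ℂ^α ⊗ ℂ^β` are matrices indexed by `α × β`. The factor `α` is the input system `A`,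
the factor `β` is the output system `B`. -/

/-- Density matrices. -/
def IsState (ρ : Matrix α α ℂ) : Prop := ρ.PosSemidef ∧ ρ.trace = 1

/-- The partial trace over the first factor. -/
def traceA (X : Matrix (α × β) (α × β) ℂ) : Matrix β β ℂ :=
  Matrix.of fun k l => ∑ i, X (i, k) (i, l)

/-- The partial trace over the second factor. -/
def traceB (X : Matrix (α × β) (α × β) ℂ) : Matrix α α ℂ :=
  Matrix.of fun i j => ∑ k, X (i, k) (j, k)

/-- The partial transpose on the first factor. -/
def transposeA (X : Matrix (α × β) (α × β) ℂ) : Matrix (α × β) (α × β) ℂ :=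
  Matrix.of fun x y => X (y.1, x.2) (x.1, y.2)

/-- The swap operator `∑ i j, |i j⟩⟨j i|`. -/
def swapOp (α : Type*) [DecidableEq α] : Matrix (α × α) (α × α) ℂ :=
  Matrix.of fun x y => if x.1 = y.2 ∧ x.2 = y.1 then 1 else 0

/-- The Jordan product `A ⋆ B = (A B + B A) / 2`. -/
def jordan (A B : Matrix α α ℂ) : Matrix α α ℂ := (1 / 2 : ℂ) • (A * B + B * A)

/-- Jamiołkowski matrices of channels: `J^{T_A} ≥ 0` and `Tr_B J = 1`. -/
def IsJamiolkowski (J : Matrix (α × β) (α × β) ℂ) : Prop :=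
  (transposeA J).PosSemidef ∧ traceB J = 1

/-- The states over time `ρ ⋆ J` between `ρ` and `σ`, with `J` a Jamiołkowski matrix such that
`Tr_A [(ρ ⊗ 1) J] = σ`. -/
def statesOverTime (ρ : Matrix α α ℂ) (σ : Matrix β β ℂ) : Set (Matrix (α × β) (α × β) ℂ) :=
  {Q | ∃ J : Matrix (α × β) (α × β) ℂ, IsJamiolkowski J ∧
    traceA ((ρ ⊗ₖ (1 : Matrix β β ℂ)) * J) = σ ∧
    Q = jordan (ρ ⊗ₖ (1 : Matrix β β ℂ)) J}

/-- The values `Tr [K Q]`, for `Q` a state over time between `ρ` and `σ`. -/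
def costValues (K : Matrix (α × β) (α × β) ℂ) (ρ : Matrix α α ℂ) (σ : Matrix β β ℂ) : Set ℝ :=
  (fun Q => (K * Q).trace.re) '' statesOverTime ρ σ

/-- The optimal transport cost with cost matrix `K`. -/
def transportCost (K : Matrix (α × β) (α × β) ℂ) (ρ : Matrix α α ℂ) (σ : Matrix β β ℂ) : ℝ :=
  sInf (costValues K ρ σ)

/-- The (normalised) unitarily invariant cost matrix `1 - S / d`, with `d` the dimension. -/
def invariantCost (α : Type*) [Fintype α] [DecidableEq α] : Matrix (α × α) (α × α) ℂ :=
  1 - (1 / (Fintype.card α : ℂ)) • swapOp α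

/-- The map `id_m ⊗ E`. -/
def ampliation (m : ℕ) (E : Matrix α α ℂ →ₗ[ℂ] Matrix β β ℂ)
    (X : Matrix (Fin m × α) (Fin m × α) ℂ) : Matrix (Fin m × β) (Fin m × β) ℂ :=
  Matrix.of fun x y => E (Matrix.of fun i j => X (x.1, i) (y.1, j)) x.2 y.2

/-- Completely positive trace preserving maps. -/
def IsCPTP (E : Matrix α α ℂ →ₗ[ℂ] Matrix β β ℂ) : Prop :=
  (∀ (m : ℕ) (X : Matrix (Fin m × α) (Fin m × α) ℂ),
    X.PosSemidef → (ampliation m E X).PosSemidef) ∧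
  ∀ X, (E X).trace = X.trace

/-- The map `X ↦ ∑ k, E_k X E_k*`. -/
def krausMap {r : ℕ} (E : Fin r → Matrix α α ℂ) : Matrix α α ℂ →ₗ[ℂ] Matrix α α ℂ :=
  ∑ k, LinearMap.mulLeft ℂ (E k) ∘ₗ LinearMap.mulRight ℂ (E k)ᴴ

/-- The joint support `supp ρ + supp σ` of two Hermitian operators on `ℂ^δ`. -/
def jointSupport (ρ σ : Matrix δ δ ℂ) : Submodule ℂ (EuclideanSpace ℂ δ) :=
  LinearMap.range (Matrix.toEuclideanLin ρ) ⊔ LinearMap.range (Matrix.toEuclideanLin σ)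

/-- The operator `|v⟩⟨w|`. -/
def ketBra (v w : EuclideanSpace ℂ δ) : Matrix δ δ ℂ :=
  Matrix.vecMulVec v.ofLp (star w.ofLp)

/-- The matrix `⟨e i| A |e j⟩` of (the compression of) an operator `A` on `ℂ^δ` with respect to an
orthonormal basis `e` of a subspace. -/
def compress {V : Submodule ℂ (EuclideanSpace ℂ δ)} (e : OrthonormalBasis ι ℂ V)
    (A : Matrix δ δ ℂ) : Matrix ι ι ℂ :=
  Matrix.of fun i j =>
    inner ℂ (e i : EuclideanSpace ℂ δ) (Matrix.toEuclideanLin A (e j : EuclideanSpace ℂ δ))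

/-! The three maximisation problems. In each of them `ρ` and `σ` are operators on `ℂ^ι`. -/

/-- Values of `Re ∑ k, Tr (E_k ρ) Tr (E_k*) + D √(∑ k, |Tr (E_k ρ)|²)`, over all finite families of
Kraus operators of channels that map `ρ` to `σ`. -/
def krausValues (D : ℝ) (ρ σ : Matrix ι ι ℂ) : Set ℝ :=
  {x | ∃ (r : ℕ) (E : Fin r → Matrix ι ι ℂ), IsCPTP (krausMap E) ∧ krausMap E ρ = σ ∧
    x = (∑ k, (E k * ρ).trace * ((E k)ᴴ).trace).re +
      D * √(∑ k, ‖(E k * ρ).trace‖ ^ 2)}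

/-- The channels that map `ρ` to `σ`. -/
def channels (ρ σ : Matrix ι ι ℂ) : Set (Matrix ι ι ℂ →ₗ[ℂ] Matrix ι ι ℂ) :=
  {E | IsCPTP E ∧ E ρ = σ}

/-- The number `∑ i j, p_i p_j ⟨i| E(|i⟩⟨j|) |j⟩`. -/
def channelRadicand (p : ι → ℝ) (E : Matrix ι ι ℂ →ₗ[ℂ] Matrix ι ι ℂ) : ℂ :=
  ∑ i, ∑ j, (p i : ℂ) * (p j : ℂ) * E (Matrix.single i j 1) i j

/-- Values of `Re ∑ i j, p_i ⟨i| E(|i⟩⟨j|) |j⟩ + D √(∑ i j, p_i p_j ⟨i| E(|i⟩⟨j|) |j⟩)`,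
over all channels that map `ρ` to `σ`. -/
def channelValues (D : ℝ) (p : ι → ℝ) (ρ σ : Matrix ι ι ℂ) : Set ℝ :=
  (fun E => (∑ i, ∑ j, (p i : ℂ) * E (Matrix.single i j 1) i j).re +
    D * √(channelRadicand p E).re) '' channels ρ σ

/-- The vector `∑ i, p_i |i i⟩`. -/
def vecDiag (p : ι → ℝ) : ι × ι → ℂ := fun x => if x.1 = x.2 then (p x.1 : ℂ) else 0

/-- The Choi matrices `C ≥ 0`, `Tr_B C = 1`, with `Tr_A [(ρᵀ ⊗ 1) C] = σ`. -/
def choiMatrices (ρ σ : Matrix ι ι ℂ) : Set (Matrix (ι × ι) (ι × ι) ℂ) :=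
  {C | C.PosSemidef ∧ traceB C = 1 ∧ traceA ((ρᵀ ⊗ₖ (1 : Matrix ι ι ℂ)) * C) = σ}

/-- The number `⟨u| C |v⟩`. -/
def braket (u : ι × ι → ℂ) (C : Matrix (ι × ι) (ι × ι) ℂ) (v : ι × ι → ℂ) : ℂ :=
  star u ⬝ᵥ (C *ᵥ v)

/-- Values of `Re ⟨ρ| C |Φ⟩ + D √⟨ρ| C |ρ⟩`, with `|ρ⟩ = ∑ i, p_i |i i⟩` and
`|Φ⟩ = ∑ i, |i i⟩`, over all Choi matrices `C` as above. -/
def choiValues (D : ℝ) (p : ι → ℝ) (ρ σ : Matrix ι ι ℂ) : Set ℝ :=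
  (fun C => (braket (vecDiag p) C (vecDiag fun _ => 1)).re +
    D * √(braket (vecDiag p) C (vecDiag p)).re) '' choiMatrices ρ σ

end QTransport

end

open QTransport

set_option linter.unusedSectionVars false

noncomputable section

namespace QTransport

variable {α β ι δ κ : Type*} [Fintype α] [DecidableEq α] [Fintype β] [DecidableEq β]
  [Fintype ι] [DecidableEq ι] [Fintype δ] [DecidableEq δ] [Fintype κ]

/-! ### Choi matrices and Kraus families -/

/-! With `J = C^{T_A}` and `C` the Choi matrix of Kraus operators `F_k`, the cost is `1 - (1/d) Re ∑
Tr(F_k ρ) Tr(F_k*)` (`trace_invariantCost_mul`), so that real part is to be maximised over channels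
on the whole space sending `ρ` to `σ`.

Let `W` be the isometry onto the joint support and `Q = 1 - W W*`, so that `Tr Q = d_⊥`. Put `E_k =
W* F_k W` and, with `ρ` compressed to the support, `a_k = Tr(E_k ρ)`. Then `Tr(F_k ρ) = a_k` and `Tr
F_k = Tr E_k + Tr(F_k Q)`. The extra term `Re ∑ a_k conj(Tr(F_k Q))` is at most `d_⊥ √(∑ |a_k|²)` by
Cauchy–Schwarz and `∑ |Tr(F_k Q)|² ≤ (Tr Q)²` (`IsKrausFamily.exists_compression`). Equality holds
for `F_k = W E_k W* + c_k Q` with `c` a unit vector parallel to `a`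
(`IsKrausFamily.exists_extension`).

On the support all three objectives are the same function of the Choi matrix (`krausValues_eq`,
`channelValues_eq`), and the admissible Choi matrices form a nonempty compact set, so the maxima
exist. -/

/-- The Choi matrix of the map with Kraus operators `E`. -/
def krausChoi (E : κ → Matrix β α ℂ) : Matrix (α × β) (α × β) ℂ :=
  Matrix.of fun x y => ∑ k, E k x.2 x.1 * star (E k y.2 y.1)

/-- The Choi matrix of a linear map. -/
def choi (L : Matrix α α ℂ →ₗ[ℂ] Matrix β β ℂ) : Matrix (α × β) (α × β) ℂ :=
  Matrix.of fun x y => L (Matrix.single x.1 y.1 1) x.2 y.2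

/-- A Kraus family of a trace preserving map that sends `ρ` to `σ`. -/
structure IsKrausFamily (E : κ → Matrix β α ℂ) (ρ : Matrix α α ℂ) (σ : Matrix β β ℂ) :
    Prop where
  sum_eq_one : ∑ k, (E k)ᴴ * E k = 1
  sum_eq : ∑ k, E k * ρ * (E k)ᴴ = σ

lemma posSemidef_krausChoi (E : κ → Matrix β α ℂ) : (krausChoi E).PosSemidef := by
  have : krausChoi E =
      (Matrix.of fun x k => E k x.2 x.1 : Matrix (α × β) κ ℂ) *
        (Matrix.of fun x k => E k x.2 x.1 : Matrix (α × β) κ ℂ)ᴴ := by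
    ext x y
    simp [krausChoi, Matrix.mul_apply]
  rw [this]
  exact Matrix.posSemidef_self_mul_conjTranspose _

lemma _root_.Matrix.PosSemidef.exists_eq_conjTranspose_mul_self {A : Matrix α α ℂ}
    (hA : A.PosSemidef) : ∃ B : Matrix α α ℂ, A = Bᴴ * B := by
  open scoped MatrixOrder in
  exact CStarAlgebra.nonneg_iff_eq_star_mul_self.mp hA.nonneg

/-- Factor `C = B* B`: the conjugated rows of `B`, reshaped into matrices, are Kraus operators. -/
lemma exists_krausChoi_eq {C : Matrix (α × β) (α × β) ℂ} (hC : C.PosSemidef) :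
    ∃ E : α × β → Matrix β α ℂ, krausChoi E = C := by
  obtain ⟨B, rfl⟩ := hC.exists_eq_conjTranspose_mul_self
  refine ⟨fun m => Matrix.of fun k i => star (B m (i, k)), ?_⟩
  ext x y
  simp [krausChoi, Matrix.mul_apply]

lemma traceB_krausChoi (E : κ → Matrix β α ℂ) :
    traceB (krausChoi E) = (∑ k, (E k)ᴴ * E k)ᵀ := by
  ext i j
  simp only [traceB, krausChoi, Matrix.of_apply, Matrix.transpose_apply, Matrix.sum_apply,
    Matrix.mul_apply, Matrix.conjTranspose_apply]
  rw [Finset.sum_comm]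
  simp only [mul_comm]

lemma traceA_kronecker_mul (A : Matrix α α ℂ) (C : Matrix (α × β) (α × β) ℂ) (k l : β) :
    traceA ((A ⊗ₖ (1 : Matrix β β ℂ)) * C) k l = ∑ i, ∑ j, A i j * C (j, k) (i, l) := by
  simp [traceA, Matrix.mul_apply, Fintype.sum_prod_type, Matrix.one_apply]

lemma traceA_kronecker_mul_krausChoi (E : κ → Matrix β α ℂ) (ρ : Matrix α α ℂ) :
    traceA ((ρᵀ ⊗ₖ (1 : Matrix β β ℂ)) * krausChoi E) = ∑ k, E k * ρ * (E k)ᴴ := by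
  ext k l
  rw [traceA_kronecker_mul]
  simp only [krausChoi, Matrix.of_apply, Matrix.transpose_apply, Matrix.sum_apply,
    Matrix.mul_apply, Matrix.conjTranspose_apply, Finset.mul_sum, Finset.sum_mul]
  rw [Finset.sum_congr rfl fun i _ => Finset.sum_comm, Finset.sum_comm]
  refine Finset.sum_congr rfl fun m _ => Finset.sum_congr rfl fun i _ =>
    Finset.sum_congr rfl fun j _ => by ring

lemma traceA_kronecker_mul_transposeA (A : Matrix α α ℂ) (C : Matrix (α × β) (α × β) ℂ) :
    traceA ((A ⊗ₖ (1 : Matrix β β ℂ)) * transposeA C) =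
      traceA ((Aᵀ ⊗ₖ (1 : Matrix β β ℂ)) * C) := by
  ext k l
  rw [traceA_kronecker_mul, traceA_kronecker_mul, Finset.sum_comm]
  rfl

lemma traceB_transposeA (C : Matrix (α × β) (α × β) ℂ) :
    traceB (transposeA C) = (traceB C)ᵀ := rfl

lemma krausChoi_comp_equiv {κ' : Type*} [Fintype κ'] (f : κ' ≃ κ) (E : κ → Matrix β α ℂ) :
    krausChoi (E ∘ f) = krausChoi E := by
  ext x y
  exact f.sum_comp fun k => E k x.2 x.1 * star (E k y.2 y.1)

lemma krausChoi_mem_choiMatrices_iff {E : κ → Matrix ι ι ℂ} {ρ σ : Matrix ι ι ℂ} :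
    krausChoi E ∈ choiMatrices ρ σ ↔ IsKrausFamily E ρ σ := by
  simp only [choiMatrices, Set.mem_ofPred_eq, posSemidef_krausChoi, true_and, traceB_krausChoi,
    traceA_kronecker_mul_krausChoi, Matrix.transpose_eq_one]
  exact ⟨fun h => ⟨h.1, h.2⟩, fun h => ⟨h.1, h.2⟩⟩

lemma exists_krausChoi_eq_of_mem {ρ σ : Matrix ι ι ℂ} {C : Matrix (ι × ι) (ι × ι) ℂ}
    (hC : C ∈ choiMatrices ρ σ) :
    ∃ (r : ℕ) (E : Fin r → Matrix ι ι ℂ), IsKrausFamily E ρ σ ∧ krausChoi E = C := by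
  obtain ⟨E, rfl⟩ := exists_krausChoi_eq hC.1
  have h := krausChoi_comp_equiv (Fintype.equivFin (ι × ι)).symm E
  rw [← h] at hC
  exact ⟨_, _, krausChoi_mem_choiMatrices_iff.mp hC, h⟩

lemma krausMap_apply {r : ℕ} (E : Fin r → Matrix ι ι ℂ) (X : Matrix ι ι ℂ) :
    krausMap E X = ∑ k, E k * X * (E k)ᴴ := by
  simp [krausMap, Matrix.mul_assoc]

lemma choi_krausMap {r : ℕ} (E : Fin r → Matrix ι ι ℂ) : choi (krausMap E) = krausChoi E := by
  ext x y
  simp [choi, krausChoi, krausMap_apply, Matrix.sum_apply, Matrix.mul_apply, Matrix.single_apply,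
    ite_and, Finset.sum_ite_eq]

lemma isCPTP_krausMap {r : ℕ} {E : Fin r → Matrix ι ι ℂ} (hE : ∑ k, (E k)ᴴ * E k = 1) :
    IsCPTP (krausMap E) := by
  refine ⟨fun m X hX => ?_, fun X => ?_⟩
  · have : ampliation m (krausMap E) X =
        ∑ k, ((1 : Matrix (Fin m) (Fin m) ℂ) ⊗ₖ E k) * X *
          ((1 : Matrix (Fin m) (Fin m) ℂ) ⊗ₖ E k)ᴴ := by
      ext x y
      simp [ampliation, krausMap_apply, Matrix.sum_apply, Matrix.mul_apply,
        Fintype.sum_prod_type, Matrix.one_apply, apply_ite (starRingEnd ℂ)]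
    rw [this]
    exact Matrix.posSemidef_sum _ fun k _ => hX.mul_mul_conjTranspose_same _
  · rw [krausMap_apply, Matrix.trace_sum,
      Finset.sum_congr rfl fun k _ => Matrix.trace_mul_cycle (E k) X (E k)ᴴ, ← Matrix.trace_sum, ← Finset.sum_mul, hE, one_mul]

/-- Up to relabelling, the Choi matrix is the ampliation, with `m = card α`, applied to the
projector onto the unnormalised maximally entangled vector `v`. -/
lemma IsCPTP.posSemidef_choi {L : Matrix α α ℂ →ₗ[ℂ] Matrix β β ℂ} (hL : IsCPTP L) :
    (choi L).PosSemidef := by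
  let f := Fintype.equivFin α
  let v : Fin (Fintype.card α) × α → ℂ := fun x => if f.symm x.1 = x.2 then 1 else 0
  have h := (hL.1 _ _ (Matrix.posSemidef_vecMulVec_self_star v)).submatrix
    (fun x : α × β => (f x.1, x.2))
  convert h using 1
  ext x y
  simp only [choi, ampliation, Matrix.of_apply, Matrix.submatrix_apply]
  refine congrArg (fun Z => L Z x.2 y.2) ?_
  ext i j
  simp only [Matrix.single_apply, Matrix.vecMulVec_apply, Matrix.of_apply, Pi.star_apply, v,
    Equiv.symm_apply_apply, apply_ite star, star_one, star_zero, mul_ite, mul_one, mul_zero]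
  split_ifs <;> simp_all

lemma map_eq_sum_choi (L : Matrix α α ℂ →ₗ[ℂ] Matrix β β ℂ) (ρ : Matrix α α ℂ) :
    traceA ((ρᵀ ⊗ₖ (1 : Matrix β β ℂ)) * choi L) = L ρ := by
  ext k l
  rw [traceA_kronecker_mul, Finset.sum_comm]
  conv_rhs => rw [Matrix.matrix_eq_sum_single ρ]
  simp only [choi, Matrix.of_apply, Matrix.transpose_apply, map_sum, Matrix.sum_apply]
  refine Finset.sum_congr rfl fun i _ => Finset.sum_congr rfl fun j _ => ?_
  have h : Matrix.single i j (ρ i j) = ρ i j • Matrix.single i j (1 : ℂ) := by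
    simp [Matrix.smul_single]
  rw [h, map_smul]
  rfl

lemma IsCPTP.traceB_choi {L : Matrix α α ℂ →ₗ[ℂ] Matrix β β ℂ} (hL : IsCPTP L) :
    traceB (choi L) = 1 := by
  ext i j
  have := hL.2 (Matrix.single i j 1)
  simp only [Matrix.trace, Matrix.diag_apply] at this
  simp only [traceB, choi, Matrix.of_apply, this]
  simp [Matrix.single_apply, Matrix.one_apply, ite_and, eq_comm]

lemma choi_mem_choiMatrices {ρ σ : Matrix ι ι ℂ} {L : Matrix ι ι ℂ →ₗ[ℂ] Matrix ι ι ℂ}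
    (hL : L ∈ channels ρ σ) : choi L ∈ choiMatrices ρ σ :=
  ⟨hL.1.posSemidef_choi, hL.1.traceB_choi, (map_eq_sum_choi L ρ).trans hL.2⟩

lemma IsKrausFamily.krausMap_mem_channels {r : ℕ} {E : Fin r → Matrix ι ι ℂ}
    {ρ σ : Matrix ι ι ℂ} (hE : IsKrausFamily E ρ σ) : krausMap E ∈ channels ρ σ :=
  ⟨isCPTP_krausMap hE.1, (krausMap_apply E ρ).trans hE.2⟩

/-! ### The three maximisation problems -/

lemma braket_vecDiag (p q : ι → ℝ) (C : Matrix (ι × ι) (ι × ι) ℂ) :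
    braket (vecDiag p) C (vecDiag q) = ∑ i, ∑ j, (p i : ℂ) * (q j : ℂ) * C (i, i) (j, j) := by
  simp only [braket, vecDiag, dotProduct, Matrix.mulVec, Fintype.sum_prod_type, Pi.star_apply,
    apply_ite star, star_zero, ite_mul, zero_mul, mul_ite, mul_zero, Finset.sum_ite_eq,
    Finset.mem_univ, if_true]
  refine Finset.sum_congr rfl fun i _ => ?_
  rw [Finset.mul_sum]
  refine Finset.sum_congr rfl fun j _ => ?_
  simp only [RCLike.star_def, Complex.conj_ofReal]
  ring

lemma channelRadicand_eq_braket (p : ι → ℝ) (L : Matrix ι ι ℂ →ₗ[ℂ] Matrix ι ι ℂ) :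
    channelRadicand p L = braket (vecDiag p) (choi L) (vecDiag p) := by
  rw [braket_vecDiag]
  rfl

lemma braket_nonneg {C : Matrix (ι × ι) (ι × ι) ℂ} (hC : C.PosSemidef) (u : ι × ι → ℂ) :
    0 ≤ braket u C u :=
  hC.dotProduct_mulVec_nonneg u

lemma channelValues_eq (D : ℝ) (p : ι → ℝ) (ρ σ : Matrix ι ι ℂ) :
    channelValues D p ρ σ = choiValues D p ρ σ := by
  have key (L : Matrix ι ι ℂ →ₗ[ℂ] Matrix ι ι ℂ) :
      ∑ i, ∑ j, (p i : ℂ) * L (Matrix.single i j 1) i j =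
        braket (vecDiag p) (choi L) (vecDiag fun _ => 1) := by
    simp [braket_vecDiag, choi]
  ext x
  constructor
  · rintro ⟨L, hL, rfl⟩
    refine ⟨choi L, choi_mem_choiMatrices hL, ?_⟩
    simp only [key, channelRadicand_eq_braket]
  · rintro ⟨C, hC, rfl⟩
    obtain ⟨r, E, hE, rfl⟩ := exists_krausChoi_eq_of_mem hC
    refine ⟨krausMap E, hE.krausMap_mem_channels, ?_⟩
    simp only [key, channelRadicand_eq_braket, choi_krausMap]

/-- The objective function of the maximisation over Kraus families. -/
def krausObjective (D : ℝ) (ρ : Matrix ι ι ℂ) (E : κ → Matrix ι ι ℂ) : ℝ :=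
  (∑ k, (E k * ρ).trace * ((E k)ᴴ).trace).re + D * √(∑ k, ‖(E k * ρ).trace‖ ^ 2)

/-- Both terms are instances, `q = 1` and `q = p`, of one sesquilinear identity for `⟨p|C|q⟩`. Hence
the objective depends on the Kraus family only through its Choi matrix. -/
lemma krausObjective_diagonal (D : ℝ) (p : ι → ℝ) (E : κ → Matrix ι ι ℂ) :
    krausObjective D (Matrix.diagonal fun i => (p i : ℂ)) E =
      (braket (vecDiag p) (krausChoi E) (vecDiag fun _ => 1)).re +
        D * √(braket (vecDiag p) (krausChoi E) (vecDiag p)).re := by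
  have h (q : ι → ℝ) : braket (vecDiag p) (krausChoi E) (vecDiag q) =
      ∑ k, (E k * Matrix.diagonal fun i => (p i : ℂ)).trace *
        star (E k * Matrix.diagonal fun i => (q i : ℂ)).trace := by
    simp only [braket_vecDiag, krausChoi, Matrix.of_apply, Finset.mul_sum, Matrix.trace,
      Matrix.diag_apply, Matrix.mul_diagonal, star_sum]
    rw [Finset.sum_congr rfl fun i _ => Finset.sum_comm, Finset.sum_comm]
    refine Finset.sum_congr rfl fun m _ => ?_
    rw [← Finset.mul_sum, Finset.sum_mul_sum]
    refine Finset.sum_congr rfl fun i _ => Finset.sum_congr rfl fun j _ => ?_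
    simp only [star_mul', RCLike.star_def, Complex.conj_ofReal]
    ring
  have h1 : (Matrix.diagonal fun _ : ι => ((1 : ℝ) : ℂ)) = 1 := by simp
  rw [h, h, h1, krausObjective]
  congr 3
  · simp [Matrix.trace_conjTranspose]
  · rw [Complex.re_sum]
    refine Finset.sum_congr rfl fun k _ => ?_
    rw [RCLike.star_def, Complex.mul_conj, Complex.ofReal_re, Complex.normSq_eq_norm_sq]

lemma krausValues_eq (D : ℝ) (p : ι → ℝ) (σ : Matrix ι ι ℂ) :
    krausValues D (Matrix.diagonal fun i => (p i : ℂ)) σ =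
      choiValues D p (Matrix.diagonal fun i => (p i : ℂ)) σ := by
  ext x
  constructor
  · rintro ⟨r, E, hE, hEσ, rfl⟩
    refine ⟨krausChoi E, choi_krausMap E ▸ choi_mem_choiMatrices ⟨hE, hEσ⟩, ?_⟩
    exact (krausObjective_diagonal D p E).symm
  · rintro ⟨C, hC, rfl⟩
    obtain ⟨r, E, hE, rfl⟩ := exists_krausChoi_eq_of_mem hC
    exact ⟨r, E, hE.krausMap_mem_channels.1, hE.krausMap_mem_channels.2,
      (krausObjective_diagonal D p E).symm⟩

/-! ### Compactness of the set of Choi matrices -/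

/-- The diagonal entries are nonnegative and those of each block sum to 1, so they are at most 1.
Writing `C` as a Gram matrix carries the bound to all entries. -/
lemma norm_apply_le_one_of_traceB_eq_one {C : Matrix (α × β) (α × β) ℂ} (hC : C.PosSemidef)
    (h : traceB C = 1) (x y : α × β) : ‖C x y‖ ≤ 1 := by
  obtain ⟨B, hB⟩ := hC.exists_eq_conjTranspose_mul_self
  have hdiag (x : α × β) : ∑ m, ‖B m x‖ ^ 2 = (C x x).re := by
    rw [hB, Matrix.mul_apply, Complex.re_sum]
    refine Finset.sum_congr rfl fun m _ => ?_
    rw [Matrix.conjTranspose_apply, RCLike.star_def, mul_comm, Complex.mul_conj,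
      Complex.ofReal_re, Complex.normSq_eq_norm_sq]
  have hle (x : α × β) : ∑ m, ‖B m x‖ ^ 2 ≤ 1 := by
    have h1 : ∑ k, (C (x.1, k) (x.1, k)).re = 1 := by
      have := congrArg Complex.re (congrFun (congrFun h x.1) x.1)
      simpa [traceB, Complex.re_sum] using this
    rw [hdiag, ← h1]
    refine Finset.single_le_sum (f := fun k => (C (x.1, k) (x.1, k)).re) (fun k _ => ?_)
      (Finset.mem_univ x.2)
    rw [← hdiag]
    positivity
  rw [hB, Matrix.mul_apply]
  calc ‖∑ m, Bᴴ x m * B m y‖ ≤ ∑ m, ‖B m x‖ * ‖B m y‖ := by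
        refine (norm_sum_le _ _).trans_eq (Finset.sum_congr rfl fun m _ => ?_)
        simp
    _ ≤ ∑ m, (‖B m x‖ ^ 2 + ‖B m y‖ ^ 2) / 2 :=
        Finset.sum_le_sum fun m _ => by nlinarith [sq_nonneg (‖B m x‖ - ‖B m y‖)]
    _ ≤ 1 := by
        rw [← Finset.sum_div, Finset.sum_add_distrib]
        linarith [hle x, hle y]

lemma isCompact_choiMatrices (ρ σ : Matrix ι ι ℂ) : IsCompact (choiMatrices ρ σ) := by
  have hK : IsCompact (Set.univ.pi fun _ : ι × ι => Set.univ.pi fun _ : ι × ι =>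
      Metric.closedBall (0 : ℂ) 1) :=
    isCompact_univ_pi fun _ => isCompact_univ_pi fun _ => isCompact_closedBall 0 1
  refine IsCompact.of_isClosed_subset hK ?_ fun C hC => ?_
  · have h1 : IsClosed {C : Matrix (ι × ι) (ι × ι) ℂ | C.PosSemidef} := by
      simp only [Matrix.posSemidef_iff_dotProduct_mulVec, Matrix.IsHermitian, Set.ofPred_and,
        Set.ofPred_forall]
      refine (isClosed_eq (by fun_prop) (by fun_prop)).inter (isClosed_iInter fun x => ?_)
      exact isClosed_le (by fun_prop) (by fun_prop)
    refine h1.inter (IsClosed.inter (isClosed_eq ?_ continuous_const)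
      (isClosed_eq ?_ continuous_const))
    · exact continuous_matrix fun i j => by simp only [traceB, Matrix.of_apply]; fun_prop
    · refine continuous_matrix fun i j => ?_
      simp only [traceA_kronecker_mul]
      fun_prop
  · exact fun x _ y _ => mem_closedBall_zero_iff.mpr
      (norm_apply_le_one_of_traceB_eq_one hC.1 hC.2.1 x y)

lemma choiMatrices_nonempty {ρ σ : Matrix ι ι ℂ} (hρ : ρ.trace = 1) (hσ : IsState σ) :
    (choiMatrices ρ σ).Nonempty := by
  -- The Choi matrix of the constant channel `X ↦ Tr(X) σ`.
  refine ⟨(1 : Matrix ι ι ℂ) ⊗ₖ σ, Matrix.PosSemidef.one.kronecker hσ.1, ?_, ?_⟩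
  · have := hσ.2
    simp only [Matrix.trace, Matrix.diag_apply] at this
    ext i j
    simp only [traceB, Matrix.of_apply, Matrix.kronecker_apply, ← Finset.mul_sum, this, mul_one]
  · ext k l
    simp only [Matrix.trace, Matrix.diag_apply] at hρ
    simp [traceA_kronecker_mul, Matrix.one_apply, ← Finset.sum_mul, hρ]

lemma exists_isGreatest_choiValues (D : ℝ) (p : ι → ℝ) {ρ σ : Matrix ι ι ℂ} (hρ : ρ.trace = 1)
    (hσ : IsState σ) : ∃ M, IsGreatest (choiValues D p ρ σ) M := by
  refine ((isCompact_choiMatrices ρ σ).image ?_).exists_isGreatest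
    ((choiMatrices_nonempty hρ hσ).image _)
  simp only [braket]
  fun_prop

/-! ### States over time in terms of Kraus families -/

/-- Partial transposition is an involution that moves the transpose onto `ρ` in the marginal
condition. -/
lemma mem_statesOverTime_iff {ρ σ : Matrix ι ι ℂ} {Q : Matrix (ι × ι) (ι × ι) ℂ} :
    Q ∈ statesOverTime ρ σ ↔ ∃ C ∈ choiMatrices ρ σ,
      Q = jordan (ρ ⊗ₖ (1 : Matrix ι ι ℂ)) (transposeA C) := by
  constructor
  · rintro ⟨J, ⟨hJ, hJ1⟩, hJσ, rfl⟩
    refine ⟨transposeA J, ⟨hJ, ?_, ?_⟩, rfl⟩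
    · rw [traceB_transposeA, hJ1, Matrix.transpose_one]
    · rw [traceA_kronecker_mul_transposeA, Matrix.transpose_transpose, hJσ]
  · rintro ⟨C, ⟨hC, hC1, hCσ⟩, rfl⟩
    refine ⟨transposeA C, ⟨hC, ?_⟩, ?_, rfl⟩
    · rw [traceB_transposeA, hC1, Matrix.transpose_one]
    · rw [traceA_kronecker_mul_transposeA, hCσ]

lemma trace_swapOp_mul (Y : Matrix (α × α) (α × α) ℂ) :
    (swapOp α * Y).trace = ∑ a, ∑ b, Y (b, a) (a, b) := by
  simp [Matrix.trace, Matrix.mul_apply, swapOp, Fintype.sum_prod_type, ite_and]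

lemma trace_traceA (Y : Matrix (α × β) (α × β) ℂ) : (traceA Y).trace = Y.trace := by
  simp only [Matrix.trace, traceA, Matrix.diag_apply, Matrix.of_apply, Fintype.sum_prod_type]
  exact Finset.sum_comm

lemma trace_swapOp_mul_mul_kronecker (E : κ → Matrix α α ℂ) (ρ : Matrix α α ℂ) :
    (swapOp α * (transposeA (krausChoi E) * (ρ ⊗ₖ (1 : Matrix α α ℂ)))).trace =
      ∑ k, (E k * ρ).trace * ((E k)ᴴ).trace := by
  have key (a b : α) :
      (transposeA (krausChoi E) * (ρ ⊗ₖ (1 : Matrix α α ℂ))) (b, a) (a, b) =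
        ∑ k, (E k * ρ) a a * ((E k)ᴴ) b b := by
    have h : (transposeA (krausChoi E) * (ρ ⊗ₖ (1 : Matrix α α ℂ))) (b, a) (a, b) =
        ∑ m, krausChoi E (m, a) (b, b) * ρ m a := by
      simp [Matrix.mul_apply, Fintype.sum_prod_type, Matrix.one_apply, transposeA]
    rw [h]
    simp only [krausChoi, Matrix.of_apply, Matrix.mul_apply, Matrix.conjTranspose_apply,
      Finset.sum_mul]
    rw [Finset.sum_comm]
    exact Finset.sum_congr rfl fun k _ => Finset.sum_congr rfl fun m _ => by ring
  rw [trace_swapOp_mul]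
  simp only [key, Matrix.trace, Matrix.diag_apply, Finset.sum_mul_sum]
  rw [Finset.sum_congr rfl fun a _ => Finset.sum_comm, Finset.sum_comm]

/-- The swap, `ρ ⊗ 1` and `J` are Hermitian, so the two orderings in the Jordan product have
conjugate traces against the swap, and averaging leaves a real part. The identity contributes `Tr σ
= 1`. The coefficient `0` drops the square root term, which is absent on the whole space. -/
lemma trace_invariantCost_mul {ρ σ : Matrix ι ι ℂ} (hρ : ρ.IsHermitian) (hσ : σ.trace = 1)
    {E : κ → Matrix ι ι ℂ} (hE : IsKrausFamily E ρ σ) :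
    (invariantCost ι *
        jordan (ρ ⊗ₖ (1 : Matrix ι ι ℂ)) (transposeA (krausChoi E))).trace =
      ((1 - (1 / (Fintype.card ι : ℝ)) * krausObjective 0 ρ E : ℝ) : ℂ) := by
  set A := ρ ⊗ₖ (1 : Matrix ι ι ℂ) with hA
  set J := transposeA (krausChoi E) with hJ
  have hAh : Aᴴ = A := by
    rw [hA, Matrix.conjTranspose_kronecker, hρ.eq, Matrix.conjTranspose_one]
  have hJh : Jᴴ = J := by
    ext x y
    simp [hJ, transposeA, krausChoi, mul_comm]
  have hSh : (swapOp ι)ᴴ = swapOp ι := by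
    ext x y
    simp [swapOp, Matrix.conjTranspose_apply, apply_ite (starRingEnd ℂ), and_comm, eq_comm]
  have hAJ : (A * J).trace = 1 := by
    rw [← trace_traceA, hA, hJ, traceA_kronecker_mul_transposeA,
      traceA_kronecker_mul_krausChoi, hE.sum_eq, hσ]
  have h1 := trace_swapOp_mul_mul_kronecker E ρ
  have h2 : (swapOp ι * (A * J)).trace = star (swapOp ι * (J * A)).trace := by
    rw [← Matrix.trace_conjTranspose, Matrix.conjTranspose_mul, Matrix.conjTranspose_mul, hAh,
      hJh, hSh, Matrix.trace_mul_comm]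
  have h3 : (swapOp ι * jordan A J).trace = ((krausObjective 0 ρ E : ℝ) : ℂ) := by
    rw [jordan, Matrix.mul_smul, Matrix.trace_smul, Matrix.mul_add, Matrix.trace_add, h2, h1,
      RCLike.star_def, add_comm, Complex.add_conj, krausObjective, zero_mul, add_zero]
    simp
  have h4 : (jordan A J).trace = 1 := by
    rw [jordan, Matrix.trace_smul, Matrix.trace_add, Matrix.trace_mul_comm J A, hAJ]
    norm_num
  rw [invariantCost, sub_mul, one_mul, Matrix.smul_mul, Matrix.trace_sub, Matrix.trace_smul, h3,
    h4]
  push_cast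
  rfl

/-! ### Reduction to a subspace -/

lemma norm_trace_conjTranspose_mul_sq_le (A B : Matrix α β ℂ) :
    ‖(Aᴴ * B).trace‖ ^ 2 ≤ (Aᴴ * A).trace.re * (Bᴴ * B).trace.re := by
  have h (A : Matrix α β ℂ) : (Aᴴ * A).trace.re = ∑ x : β × α, ‖A x.2 x.1‖ ^ 2 := by
    simp only [Matrix.trace, Matrix.diag_apply, Matrix.mul_apply, Fintype.sum_prod_type,
      Complex.re_sum, Matrix.conjTranspose_apply, RCLike.star_def]
    refine Finset.sum_congr rfl fun i _ => Finset.sum_congr rfl fun j _ => ?_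
    rw [mul_comm, Complex.mul_conj, Complex.ofReal_re, Complex.normSq_eq_norm_sq]
  have hle : ‖(Aᴴ * B).trace‖ ≤ ∑ x : β × α, ‖A x.2 x.1‖ * ‖B x.2 x.1‖ := by
    have : (Aᴴ * B).trace = ∑ x : β × α, star (A x.2 x.1) * B x.2 x.1 := by
      simp [Matrix.trace, Matrix.mul_apply, Fintype.sum_prod_type]
    rw [this]
    exact (norm_sum_le _ _).trans_eq (Finset.sum_congr rfl fun x _ => by simp)
  rw [h, h]
  exact (pow_le_pow_left₀ (norm_nonneg _) hle 2).trans (Finset.sum_mul_sq_le_sq_mul_sq _ _ _)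

/-- `Tr(F_k Q)` is the Hilbert–Schmidt product of `Q` and `F_k Q`. Cauchy–Schwarz gives one factor
`Tr Q`, and summing `Tr(Q F_k* F_k Q)` gives the other. -/
lemma sum_norm_trace_mul_sq_le {F : κ → Matrix δ δ ℂ} (hF : ∑ k, (F k)ᴴ * F k = 1)
    {Q : Matrix δ δ ℂ} (hQ : Qᴴ = Q) (hQ2 : Q * Q = Q) :
    ∑ k, ‖(F k * Q).trace‖ ^ 2 ≤ Q.trace.re ^ 2 := by
  have h (k : κ) : ‖(F k * Q).trace‖ ^ 2 ≤ Q.trace.re * (Q * ((F k)ᴴ * F k) * Q).trace.re := by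
    have h1 : (F k * Q).trace = (Qᴴ * (F k * Q)).trace := by
      rw [hQ, Matrix.trace_mul_comm Q, Matrix.mul_assoc, hQ2]
    rw [h1]
    refine (norm_trace_conjTranspose_mul_sq_le Q (F k * Q)).trans_eq ?_
    rw [hQ, hQ2, Matrix.conjTranspose_mul, hQ]
    simp only [Matrix.mul_assoc]
  refine (Finset.sum_le_sum fun k _ => h k).trans_eq ?_
  rw [← Finset.mul_sum, ← Complex.re_sum, ← Matrix.trace_sum, ← Finset.sum_mul, ← Finset.mul_sum,
    hF, mul_one, hQ2, sq]

lemma re_sum_mul_star_le (a c : κ → ℂ) :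
    (∑ k, a k * star (c k)).re ≤ √(∑ k, ‖a k‖ ^ 2) * √(∑ k, ‖c k‖ ^ 2) :=
  calc (∑ k, a k * star (c k)).re ≤ ‖∑ k, a k * star (c k)‖ := Complex.re_le_norm _
    _ ≤ ∑ k, ‖a k‖ * ‖c k‖ :=
        (norm_sum_le _ _).trans_eq (Finset.sum_congr rfl fun x _ => by simp)
    _ ≤ _ := Real.sum_mul_le_sqrt_mul_sqrt _ _ _

/-- The equality case of Cauchy–Schwarz: `c` is `a` normalised, or any unit vector if `a = 0`. -/
lemma exists_sum_mul_star_eq_sqrt [Nonempty κ] (a : κ → ℂ) :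
    ∃ c : κ → ℂ, ∑ k, ‖c k‖ ^ 2 = 1 ∧ ∑ k, a k * star (c k) = (√(∑ k, ‖a k‖ ^ 2) : ℝ) := by
  classical
  set s := ∑ k, ‖a k‖ ^ 2 with hs
  have hs0 : 0 ≤ s := by positivity
  rcases hs0.eq_or_lt with h0 | h0
  · have ha (k : κ) : a k = 0 := by
      have := (Finset.sum_eq_zero_iff_of_nonneg (fun k _ => sq_nonneg ‖a k‖)).mp h0.symm k
        (Finset.mem_univ k)
      simpa using this
    obtain ⟨k₀⟩ := ‹Nonempty κ›
    refine ⟨Pi.single k₀ 1, ?_, ?_⟩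
    · rw [Finset.sum_eq_single k₀] <;> simp +contextual
    · simp [ha, ← h0]
  · refine ⟨fun k => a k / (√s : ℝ), ?_, ?_⟩
    · simp only [norm_div, Complex.norm_real, div_pow, Real.norm_eq_abs, sq_abs, Real.sq_sqrt hs0]
      rw [← Finset.sum_div, div_self h0.ne']
    · have h1 (k : κ) : a k * star (a k / ((√s : ℝ) : ℂ)) = ((‖a k‖ ^ 2 / √s : ℝ) : ℂ) := by
        rw [star_div₀, RCLike.star_def, Complex.conj_ofReal, ← mul_div_assoc,
          Complex.mul_conj, Complex.normSq_eq_norm_sq, Complex.ofReal_div]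
      simp only [h1]
      rw [← Complex.ofReal_sum, ← Finset.sum_div, ← hs, Real.div_sqrt]

lemma mul_eq_zero_of_trace_mul_mul_conjTranspose_eq_zero {ρ : Matrix α α ℂ} (hρ : ρ.PosSemidef)
    {B : Matrix α α ℂ} (h : (B * ρ * Bᴴ).trace = 0) : B * ρ = 0 := by
  obtain ⟨R, rfl⟩ := hρ.exists_eq_conjTranspose_mul_self
  have h1 : B * (Rᴴ * R) * Bᴴ = (B * Rᴴ) * (B * Rᴴ)ᴴ := by
    simp [Matrix.mul_assoc]
  rw [h1, Matrix.trace_mul_conjTranspose_self_eq_zero_iff] at h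
  rw [← Matrix.mul_assoc, h, Matrix.zero_mul]

lemma complement_isometry {W : Matrix δ ι ℂ} (hW : Wᴴ * W = 1) :
    Wᴴ * (1 - W * Wᴴ) = 0 ∧ (1 - W * Wᴴ) * W = 0 ∧ (1 - W * Wᴴ)ᴴ = 1 - W * Wᴴ ∧
      (1 - W * Wᴴ) * (1 - W * Wᴴ) = 1 - W * Wᴴ := by
  have h1 : Wᴴ * (1 - W * Wᴴ) = 0 := by
    rw [Matrix.mul_sub, Matrix.mul_one, ← Matrix.mul_assoc, hW, Matrix.one_mul, sub_self]
  refine ⟨h1, ?_, by simp, ?_⟩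
  · rw [Matrix.sub_mul, Matrix.one_mul, Matrix.mul_assoc, hW, Matrix.mul_one, sub_self]
  · nth_rewrite 1 [Matrix.sub_mul]
    rw [Matrix.one_mul, Matrix.mul_assoc, h1, Matrix.mul_zero, sub_zero]

/-- Compressing a channel on the whole space to a subspace, and completing it to a channel. -/
lemma IsKrausFamily.exists_compression {W : Matrix δ ι ℂ} (hW : Wᴴ * W = 1)
    {ρ σ : Matrix ι ι ℂ} (hρ : ρ.PosSemidef) (hρσ : ρ.trace = σ.trace)
    {F : κ → Matrix δ δ ℂ} (hF : IsKrausFamily F (W * ρ * Wᴴ) (W * σ * Wᴴ)) :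
    ∃ E : Option κ → Matrix ι ι ℂ, IsKrausFamily E ρ σ ∧
      krausObjective 0 (W * ρ * Wᴴ) F ≤ krausObjective (1 - W * Wᴴ).trace.re ρ E := by
  obtain ⟨-, -, hQh, hQ2⟩ := complement_isometry hW
  set Q := 1 - W * Wᴴ with hQ
  have hQpsd : Q.PosSemidef := by
    rw [← hQ2]; nth_rewrite 1 [← hQh]; exact Matrix.posSemidef_conjTranspose_mul_self Q
  -- The compressed family may lose trace: the defect is the weight that the `F_k` send from the
  -- subspace into its complement. A factor `B` of this defect is the missing Kraus operator.
  have hR : (1 - ∑ k, (Wᴴ * F k * W)ᴴ * (Wᴴ * F k * W)).PosSemidef := by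
    have : 1 - ∑ k, (Wᴴ * F k * W)ᴴ * (Wᴴ * F k * W) =
        ∑ k, (F k * W)ᴴ * Q * (F k * W) := by
      have h1 : ∑ k, (F k * W)ᴴ * (F k * W) = 1 := by
        have : ∑ k, (F k * W)ᴴ * (F k * W) = Wᴴ * (∑ k, (F k)ᴴ * F k) * W := by
          simp [Matrix.mul_sum, Matrix.sum_mul, Matrix.mul_assoc]
        rw [this, hF.sum_eq_one, Matrix.mul_one, hW]
      rw [← h1, ← Finset.sum_sub_distrib]
      refine Finset.sum_congr rfl fun k _ => ?_
      simp [hQ, Matrix.mul_sub, Matrix.sub_mul, Matrix.mul_assoc]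
    rw [this]
    exact Matrix.posSemidef_sum _ fun k _ => hQpsd.conjTranspose_mul_mul_same _
  obtain ⟨B, hB⟩ := hR.exists_eq_conjTranspose_mul_self
  have hσ : ∑ k, (Wᴴ * F k * W) * ρ * (Wᴴ * F k * W)ᴴ = σ := by
    have : ∑ k, (Wᴴ * F k * W) * ρ * (Wᴴ * F k * W)ᴴ =
        Wᴴ * (∑ k, F k * (W * ρ * Wᴴ) * (F k)ᴴ) * W := by
      simp [Matrix.mul_sum, Matrix.sum_mul, Matrix.mul_assoc]
    rw [this, hF.sum_eq, Matrix.mul_assoc W, ← Matrix.mul_assoc, hW, Matrix.one_mul,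
      Matrix.mul_assoc, hW, Matrix.mul_one]
  -- `Tr(B ρ B*) = Tr ρ - Tr σ = 0`, so the added operator changes neither the output state nor the
  -- objective.
  have hBρ : B * ρ = 0 := by
    refine mul_eq_zero_of_trace_mul_mul_conjTranspose_eq_zero hρ ?_
    rw [Matrix.trace_mul_cycle, ← hB, Matrix.sub_mul, Matrix.one_mul, Matrix.trace_sub, hρσ,
      ← hσ, Matrix.sum_mul, Matrix.trace_sum, Matrix.trace_sum, sub_eq_zero]
    exact Finset.sum_congr rfl fun k _ => Matrix.trace_mul_cycle _ _ _
  refine ⟨fun o => o.elim B fun k => Wᴴ * F k * W, ⟨?_, ?_⟩, ?_⟩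
  · rw [Fintype.sum_option]
    simp only [Option.elim_none, Option.elim_some]
    rw [← hB, sub_add_cancel]
  · rw [Fintype.sum_option]
    simp only [Option.elim_none, Option.elim_some]
    rw [hBρ, Matrix.zero_mul, zero_add, hσ]
  · have ha (k : κ) : (F k * (W * ρ * Wᴴ)).trace = (Wᴴ * F k * W * ρ).trace := by
      rw [Matrix.mul_assoc W, ← Matrix.mul_assoc (F k), Matrix.trace_mul_comm]
      rw [Matrix.mul_assoc, Matrix.trace_mul_comm]
      simp only [Matrix.mul_assoc]
    -- Splitting the trace along `1 = W W* + Q` isolates the term to be bounded by Cauchy–Schwarz.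
    have hc (k : κ) : ((F k)ᴴ).trace =
        ((Wᴴ * F k * W)ᴴ).trace + star (F k * Q).trace := by
      rw [Matrix.trace_conjTranspose, Matrix.trace_conjTranspose, ← star_add, hQ,
        Matrix.mul_sub, Matrix.mul_one, Matrix.trace_sub, ← Matrix.mul_assoc,
        Matrix.trace_mul_comm (F k * W), Matrix.mul_assoc Wᴴ, add_sub_cancel]
    have hQ0 : 0 ≤ Q.trace.re := (Complex.nonneg_iff.mp hQpsd.trace_nonneg).1
    simp only [krausObjective, Fintype.sum_option, Option.elim_none, Option.elim_some, hBρ, ha, hc,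
      Matrix.trace_zero, zero_mul, zero_add, norm_zero, add_zero, mul_add, Finset.sum_add_distrib,
      Complex.add_re, ne_eq, OfNat.ofNat_ne_zero, not_false_eq_true, zero_pow]
    gcongr
    refine (re_sum_mul_star_le _ _).trans ?_
    rw [mul_comm]
    gcongr
    exact (Real.sqrt_le_sqrt (sum_norm_trace_mul_sq_le hF.sum_eq_one hQh hQ2)).trans_eq
      (Real.sqrt_sq hQ0)

/-- Extending a channel on a subspace to a channel on the whole space. -/
lemma IsKrausFamily.exists_extension [Nonempty κ] {W : Matrix δ ι ℂ} (hW : Wᴴ * W = 1)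
    {ρ σ : Matrix ι ι ℂ} {E : κ → Matrix ι ι ℂ} (hE : IsKrausFamily E ρ σ) :
    ∃ F : κ → Matrix δ δ ℂ, IsKrausFamily F (W * ρ * Wᴴ) (W * σ * Wᴴ) ∧
      krausObjective 0 (W * ρ * Wᴴ) F = krausObjective (1 - W * Wᴴ).trace.re ρ E := by
  obtain ⟨hWQ, hQW, hQh, hQ2⟩ := complement_isometry hW
  have hQ : 1 - W * Wᴴ + W * Wᴴ = 1 := sub_add_cancel _ _
  set Q := 1 - W * Wᴴ
  have hQt : star Q.trace = Q.trace := by rw [← Matrix.trace_conjTranspose, hQh]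
  obtain ⟨c, hc1, hc⟩ := exists_sum_mul_star_eq_sqrt fun k => (E k * ρ).trace
  have hWW (X : Matrix ι δ ℂ) : Wᴴ * (W * X) = X := by rw [← Matrix.mul_assoc, hW, Matrix.one_mul]
  have hWW' (X : Matrix ι ι ℂ) : Wᴴ * (W * X) = X := by
    rw [← Matrix.mul_assoc, hW, Matrix.one_mul]
  have hQWX (X : Matrix ι δ ℂ) : Q * (W * X) = 0 := by
    rw [← Matrix.mul_assoc, hQW, Matrix.zero_mul]
  have hF (k : κ) : (W * E k * Wᴴ + c k • Q) * (W * ρ * Wᴴ) = W * (E k * ρ) * Wᴴ := by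
    simp [Matrix.add_mul, Matrix.mul_assoc, hWW, hQWX]
  -- Block diagonal operators: `∑ |c_k|² = 1` makes the family trace preserving on the complement,
  -- and the choice of `c` saturates Cauchy–Schwarz.
  refine ⟨fun k => W * E k * Wᴴ + c k • Q, ⟨?_, ?_⟩, ?_⟩
  · have h (k : κ) : (W * E k * Wᴴ + c k • Q)ᴴ * (W * E k * Wᴴ + c k • Q) =
        W * ((E k)ᴴ * E k) * Wᴴ + ((‖c k‖ ^ 2 : ℝ) : ℂ) • Q := by
      rw [← Complex.normSq_eq_norm_sq, ← Complex.mul_conj]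
      simp [Matrix.add_mul, Matrix.mul_add, Matrix.mul_assoc, hWW, hQWX, hQh, hWQ, hQ2, smul_smul]
    simp only [h]
    rw [Finset.sum_add_distrib, ← Finset.sum_smul, ← Complex.ofReal_sum, hc1, ← Matrix.sum_mul,
      ← Matrix.mul_sum, hE.sum_eq_one, Matrix.mul_one, Complex.ofReal_one, one_smul, add_comm, hQ]
  · have h (k : κ) : W * (E k * ρ) * Wᴴ * (W * E k * Wᴴ + c k • Q)ᴴ =
        W * (E k * ρ * (E k)ᴴ) * Wᴴ := by
      simp [Matrix.mul_add, Matrix.mul_assoc, hWW, hQh, hWQ]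
    simp only [hF, h]
    rw [← Matrix.sum_mul, ← Matrix.mul_sum, hE.sum_eq]
  · have ha (k : κ) : (W * (E k * ρ) * Wᴴ).trace = (E k * ρ).trace := by
      rw [Matrix.trace_mul_comm, hWW']
    have hb (k : κ) : ((W * E k * Wᴴ + c k • Q)ᴴ).trace =
        ((E k)ᴴ).trace + Q.trace * star (c k) := by
      rw [Matrix.trace_conjTranspose, Matrix.trace_add, Matrix.trace_smul, Matrix.trace_mul_comm,
        hWW', star_add, Matrix.trace_conjTranspose, smul_eq_mul, star_mul', hQt, mul_comm]
    have hQr : Q.trace = (Q.trace.re : ℂ) := (Complex.conj_eq_iff_re.mp hQt).symm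
    simp only [krausObjective, hF, ha, hb, mul_add, Finset.sum_add_distrib, zero_mul, add_zero,
      Complex.add_re, mul_left_comm _ Q.trace]
    rw [← Finset.mul_sum, hc, hQr, ← Complex.ofReal_mul, Complex.ofReal_re, Complex.ofReal_re]

/-! ### The joint support -/

/-- The matrix whose columns are the vectors of an orthonormal basis of a subspace. -/
def basisMatrix {V : Submodule ℂ (EuclideanSpace ℂ δ)} (e : OrthonormalBasis ι ℂ V) :
    Matrix δ ι ℂ :=
  Matrix.of fun x i => (e i : EuclideanSpace ℂ δ) x

section BasisMatrix

variable {V : Submodule ℂ (EuclideanSpace ℂ δ)} (e : OrthonormalBasis ι ℂ V)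

lemma conjTranspose_basisMatrix_mulVec (v : EuclideanSpace ℂ δ) (i : ι) :
    ((basisMatrix e)ᴴ *ᵥ v.ofLp) i = inner ℂ (e i : EuclideanSpace ℂ δ) v := by
  simp [basisMatrix, Matrix.mulVec, dotProduct, PiLp.inner_apply, mul_comm]

lemma compress_eq (A : Matrix δ δ ℂ) :
    compress e A = (basisMatrix e)ᴴ * A * basisMatrix e := by
  ext i j
  rw [compress, Matrix.of_apply, ← conjTranspose_basisMatrix_mulVec,
    Matrix.toEuclideanLin, Matrix.ofLp_toLpLin, Matrix.toLin'_apply, Matrix.mulVec_mulVec]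
  rfl

lemma conjTranspose_basisMatrix_mul_self : (basisMatrix e)ᴴ * basisMatrix e = 1 := by
  ext i j
  have h := conjTranspose_basisMatrix_mulVec e (e j : EuclideanSpace ℂ δ) i
  rw [← Submodule.coe_inner, orthonormal_iff_ite.mp e.orthonormal i j] at h
  rw [Matrix.one_apply, ← h]
  rfl

lemma basisMatrix_mul_conjTranspose_mulVec {v : EuclideanSpace ℂ δ} (hv : v ∈ V) :
    (basisMatrix e * (basisMatrix e)ᴴ) *ᵥ v.ofLp = v.ofLp := by
  have h := congrArg (fun w : V => (w : EuclideanSpace ℂ δ)) (e.sum_repr' ⟨v, hv⟩)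
  ext x
  have hx := congrArg (fun w : EuclideanSpace ℂ δ => w x) h
  rw [← Matrix.mulVec_mulVec]
  simp only [Submodule.coe_inner, Submodule.coe_sum, Submodule.coe_smul] at hx
  rw [← hx]
  simp only [Matrix.mulVec, dotProduct, ← conjTranspose_basisMatrix_mulVec]
  simp [basisMatrix, mul_comm]

lemma basisMatrix_mul_conjTranspose_mul {A : Matrix δ δ ℂ}
    (hA : LinearMap.range (Matrix.toEuclideanLin A) ≤ V) :
    basisMatrix e * (basisMatrix e)ᴴ * A = A := by
  refine Matrix.ext_of_mulVec_single fun j => ?_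
  rw [← Matrix.mulVec_mulVec]
  exact basisMatrix_mul_conjTranspose_mulVec e
    (hA ⟨WithLp.toLp 2 (Pi.single j 1), rfl⟩)

lemma basisMatrix_mul_compress_mul {A : Matrix δ δ ℂ} (hAh : A.IsHermitian)
    (hA : LinearMap.range (Matrix.toEuclideanLin A) ≤ V) :
    basisMatrix e * compress e A * (basisMatrix e)ᴴ = A := by
  have h := basisMatrix_mul_conjTranspose_mul e hA
  have h' : A * (basisMatrix e * (basisMatrix e)ᴴ) = A := by
    have := congrArg Matrix.conjTranspose h
    simpa [hAh.eq] using this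
  rw [compress_eq]
  calc _ = (basisMatrix e * (basisMatrix e)ᴴ * A) * (basisMatrix e * (basisMatrix e)ᴴ) := by
        simp only [Matrix.mul_assoc]
    _ = A := by rw [h, h']

lemma isState_compress {A : Matrix δ δ ℂ} (hAs : IsState A)
    (hA : LinearMap.range (Matrix.toEuclideanLin A) ≤ V) : IsState (compress e A) := by
  rw [compress_eq]
  refine ⟨hAs.1.conjTranspose_mul_mul_same _, ?_⟩
  rw [Matrix.trace_mul_cycle, basisMatrix_mul_conjTranspose_mul e hA, hAs.2]

lemma compress_sum_ketBra (p : ι → ℝ) :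
    compress e (∑ i, (p i : ℂ) • ketBra (e i : EuclideanSpace ℂ δ) (e i : EuclideanSpace ℂ δ)) =
      Matrix.diagonal fun i => (p i : ℂ) := by
  have h : ∑ i, (p i : ℂ) • ketBra (e i : EuclideanSpace ℂ δ) (e i : EuclideanSpace ℂ δ) =
      basisMatrix e * (Matrix.diagonal fun i => (p i : ℂ)) * (basisMatrix e)ᴴ := by
    ext x y
    rw [Matrix.mul_apply]
    simp only [Matrix.sum_apply, Matrix.mul_diagonal]
    refine Finset.sum_congr rfl fun i _ => ?_
    simp [ketBra, basisMatrix, Matrix.vecMulVec_apply]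
    ring
  rw [h, compress_eq]
  calc _ = ((basisMatrix e)ᴴ * basisMatrix e) * (Matrix.diagonal fun i => (p i : ℂ)) *
        ((basisMatrix e)ᴴ * basisMatrix e) := by simp only [Matrix.mul_assoc]
    _ = _ := by rw [conjTranspose_basisMatrix_mul_self, Matrix.one_mul, Matrix.mul_one]

lemma trace_one_sub_basisMatrix :
    (1 - basisMatrix e * (basisMatrix e)ᴴ).trace.re = (Module.finrank ℂ Vᗮ : ℝ) := by
  have h1 : Module.finrank ℂ V = Fintype.card ι := Module.finrank_eq_card_basis e.toBasis
  have h2 := V.finrank_add_finrank_orthogonal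
  rw [h1, finrank_euclideanSpace] at h2
  rw [Matrix.trace_sub, Matrix.trace_one, Matrix.trace_mul_comm,
    conjTranspose_basisMatrix_mul_self, Matrix.trace_one, ← h2]
  simp

end BasisMatrix

end QTransport

end

open QTransport

/-! ### The optimal transport cost -/

theorem mainTheorem2 {δ ι : Type*} [Fintype δ] [DecidableEq δ] [Fintype ι] [DecidableEq ι]
    (ρ σ : Matrix δ δ ℂ) (hρ : IsState ρ) (hσ : IsState σ)
    (e : OrthonormalBasis ι ℂ (jointSupport ρ σ)) (p : ι → ℝ)
    (hp : ρ = ∑ i, (p i : ℂ) •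
      ketBra (e i : EuclideanSpace ℂ δ) (e i : EuclideanSpace ℂ δ))
    (dperp : ℕ) (hdperp : dperp = Module.finrank ℂ (jointSupport ρ σ)ᗮ) :
    -- the expressions that are read as real numbers are real, the radicands nonnegative
    (∀ Q ∈ statesOverTime ρ σ, (invariantCost δ * Q).trace.im = 0) ∧
    (∀ E ∈ channels (compress e ρ) (compress e σ), 0 ≤ channelRadicand p E) ∧
    (∀ C ∈ choiMatrices (compress e ρ) (compress e σ),
      0 ≤ braket (vecDiag p) C (vecDiag p)) ∧
    -- the optimal cost is attained
    IsLeast (costValues (invariantCost δ) ρ σ) (transportCost (invariantCost δ) ρ σ) ∧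
    -- the three maxima exist, agree, and give the optimal cost
    ∃ M : ℝ,
      IsGreatest (krausValues dperp (compress e ρ) (compress e σ)) M ∧
      IsGreatest (channelValues dperp p (compress e ρ) (compress e σ)) M ∧
      IsGreatest (choiValues dperp p (compress e ρ) (compress e σ)) M ∧
      transportCost (invariantCost δ) ρ σ = 1 - (1 / (Fintype.card δ : ℝ)) * M := by
  have hρV : LinearMap.range (Matrix.toEuclideanLin ρ) ≤ jointSupport ρ σ := le_sup_left
  have hσV : LinearMap.range (Matrix.toEuclideanLin σ) ≤ jointSupport ρ σ := le_sup_right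
  have hρS := isState_compress e hρ hρV
  have hσS := isState_compress e hσ hσV
  have hWρ := basisMatrix_mul_compress_mul e hρ.1.1 hρV
  have hWσ := basisMatrix_mul_compress_mul e hσ.1.1 hσV
  have hW := conjTranspose_basisMatrix_mul_self e
  have hQ := trace_one_sub_basisMatrix e
  rw [← hdperp] at hQ
  have hdiag : compress e ρ = Matrix.diagonal fun i => (p i : ℂ) :=
    (congrArg (compress e) hp).trans (compress_sum_ketBra e p)
  set ρS := compress e ρ
  set σS := compress e σ
  obtain ⟨M, hM⟩ := exists_isGreatest_choiValues dperp p hρS.2 hσS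
  have hk : krausValues dperp ρS σS = choiValues dperp p ρS σS := by
    rw [hdiag, krausValues_eq]
  have hleast : IsLeast (costValues (invariantCost δ) ρ σ)
      (1 - (1 / (Fintype.card δ : ℝ)) * M) := by
    constructor
    · obtain ⟨C, hC, hCM⟩ := hM.1
      obtain ⟨r, E, hE, rfl⟩ := exists_krausChoi_eq_of_mem hC
      -- An empty family would force `σ = 0`, against `Tr σ = 1`.
      have : Nonempty (Fin r) := by
        by_contra h
        rw [not_nonempty_iff] at h
        have h0 := hE.sum_eq
        rw [Finset.univ_eq_empty, Finset.sum_empty] at h0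
        simpa [← h0] using hσS.2
      obtain ⟨F, hF, hFE⟩ := hE.exists_extension hW
      rw [hWρ, hWσ] at hF
      rw [hWρ, hQ, hdiag, krausObjective_diagonal] at hFE
      refine ⟨_, mem_statesOverTime_iff.mpr
        ⟨_, krausChoi_mem_choiMatrices_iff.mpr hF, rfl⟩, ?_⟩
      simp only [trace_invariantCost_mul hρ.1.1 hσ.2 hF, Complex.ofReal_re, hFE]
      rw [← hCM]
    · rintro _ ⟨Q, hQmem, rfl⟩
      obtain ⟨C, hC, rfl⟩ := mem_statesOverTime_iff.mp hQmem
      obtain ⟨r, F, hF, rfl⟩ := exists_krausChoi_eq_of_mem hC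
      simp only [trace_invariantCost_mul hρ.1.1 hσ.2 hF, Complex.ofReal_re]
      gcongr
      have hF' : IsKrausFamily F (basisMatrix e * ρS * (basisMatrix e)ᴴ)
          (basisMatrix e * σS * (basisMatrix e)ᴴ) := by
        rwa [hWρ, hWσ]
      obtain ⟨E, hE, hFE⟩ := hF'.exists_compression hW hρS.1 (hρS.2.trans hσS.2.symm)
      rw [hWρ, hQ] at hFE
      -- The family `E` is indexed by `Option (Fin r)`; passing to its Choi matrix makes the index
      -- type irrelevant.
      refine hFE.trans (hM.2 ⟨krausChoi E, krausChoi_mem_choiMatrices_iff.mpr hE, ?_⟩)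
      rw [hdiag, krausObjective_diagonal]
  have hcost : transportCost (invariantCost δ) ρ σ = 1 - (1 / (Fintype.card δ : ℝ)) * M :=
    hleast.csInf_eq
  refine ⟨fun Q hQmem => ?_, fun E hE => ?_, fun C hC => braket_nonneg hC.1 _, ?_, M, ?_, ?_, hM,
    hcost⟩
  · obtain ⟨C, hC, rfl⟩ := mem_statesOverTime_iff.mp hQmem
    obtain ⟨r, F, hF, rfl⟩ := exists_krausChoi_eq_of_mem hC
    rw [trace_invariantCost_mul hρ.1.1 hσ.2 hF, Complex.ofReal_im]
  · rw [channelRadicand_eq_braket]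
    exact braket_nonneg (choi_mem_choiMatrices hE).1 _
  · rwa [hcost]
  · rwa [hk]
  · rwa [channelValues_eq]
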